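/- **Setup.** For $d\ge 1$ put $\omega=e^{2\pi i/d}$, $\tau=-e^{\pi i/d}$, and on $\mathbb C^d$ with basis $\{|k\rangle\}_{k\in\mathbb Z_d}$ let $Z|k\rangle=\omega^k|k\rangle$, $X|k\rangle=|k+1\rangle$. For $a=(a_1,a_2)$ with $a_1,a_2\in\{0,\dots,d-1\}$ let $D_a=\tau^{a_1a_2}X^{a_1}Z^{a_2}$, and for $\mathbf a=(\mathbf a_1,\dots,\mathbf a_n)\in\mathbb Z_d^{2n}$ let $D_{\mathbf a}=D_{\mathbf a_1}\otimes\cdots\otimes D_{\mathbf a_n}$ on $(\mathbb C^d)^{\otimes n}$. Let $[\mathbf a,\mathbf b]=\sum_i(a_{i,2}b_{i,1}-a_{i,1}b_{i,2})\in\mathbb Z_d$. The linear stabilizer entropy of a unit vector $\psi\in(\mathbb C^d)^{\otimes n}$ is $$M(\psi)=1-\frac1{d^n}\sum_{\mathbf a\in\mathbb Z_d^{2n}}\bigl|\mathrm{Tr}(D_{\mathbf a}^\dagger|\psi\rangle\langle\psi|)\bigr|^4 .$$ For a linear isometry $\mathcal E:(\mathbb C^{D})^{\otimes m}\to(\mathbb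 C^d)^{\otimes n}$ the average stabilizer entropy gap is $\Delta M(\mathcal E)=\mathbb E_\psi\,[M_B(\mathcal E\psi)-M_S(\psi)]$, where $M_B$ is the entropy on $n$ qudits of local dimension $d$, $M_S$ the one on $m$ qudits of local dimension $D$, and $\psi$ is a Haar-random (uniformly distributed) unit vector of $(\mathbb C^{D})^{\otimes m}$. **Theorem.** Let $\mathcal S\subseteq\mathbb Z_d^{2n}$ be a totally isotropic subgroup ($[\mathbf a,\mathbf b]=0$ for all $\mathbf a,\mathbf b\in\mathcal S$) whose stabilizer codespace for the trivial homomorphism, $\mathcal C_{\mathcal S}=\{v: D_{\mathbf a}v=v\ \ \forall \mathbf a\in\mathcal S\}$, is nonzero (this is automatic for odd $d$). Let $d_B=d^n$, let $D\ge1$ and $m\ge0$ be such that $d_S:=\dim\mathcal C_{\mathcal S}=D^m$, and let $\mathcal E_{\mathcal S}:(\mathbb C^D)^{\otimes m}\to(\mathbb C^d)^{\otimes n}$ be a linear isometry with range $\mathcal C_{\mathcal S}$. Then $d_S|\mathcal S|=d_B$ and $$\Delta M(\mathcal E_{\mathcal S})=\frac{\alpha\, d_B-|A_{\mathcal S}|\,d_S}{d_B(d_S+1)(d_S+2)(d_S+3)},$$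 where $$A_{\mathcal S}=\{\mathbf a\in\mathbb Z_d^{2n}: 2\mathbf a\in\mathcal S\text{ and }[\mathbf a,\mathbf b]=0\ \ \forall\mathbf b\in\mathcal S\},$$ and $\alpha=1$ if $d_S$ is odd; $\alpha=4$ if $d_S$ is even and the small space is a single qudit ($m=1$, $D=d_S$); $\alpha=d_S^2$ if the small space is $m$ qubits ($D=2$, $d_S=2^m$); and, in general, $\alpha=4^m$ if the small space is $m$ qudits of even local dimension $D$. -/

import Mathlib

open MeasureTheory
open scoped Matrix

noncomputable section

/-- The phase space `(ℤ_d × ℤ_d)^n` of symplectic indices of `n` qudits of local dimension `d`. -/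
abbrev PhaseSpace (d n : ℕ) : Type := Fin n → ZMod d × ZMod d

/-- The Hilbert space of `n` qudits, `(ℂ^d)^{⊗ n}`, with the computational basis labelled by
`(ℤ_d)^n`. -/
abbrev QuditSpace (d n : ℕ) : Type := EuclideanSpace ℂ (Fin n → ZMod d)

/-- `ω = exp (2 π i / d)`. -/
def omegaPhase (d : ℕ) : ℂ := Complex.exp (2 * Real.pi * Complex.I / d)

/-- `τ = - exp (π i / d)`. -/
def tauPhase (d : ℕ) : ℂ := -Complex.exp (Real.pi * Complex.I / d)

/-- The clock operator, `Z |k⟩ = ω^k |k⟩`. -/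
def clockMatrix (d : ℕ) : Matrix (ZMod d) (ZMod d) ℂ :=
  Matrix.diagonal fun k => omegaPhase d ^ k.val

/-- The shift operator, `X |k⟩ = |k + 1⟩`. -/
def shiftMatrix (d : ℕ) : Matrix (ZMod d) (ZMod d) ℂ :=
  Matrix.of fun j k => if j = k + 1 then 1 else 0

/-- The displacement operator `τ^{a₁ a₂} X^{a₁} Z^{a₂}` of one qudit, where `a₁, a₂` are represented
by integers in `{0, …, d - 1}`. -/
def displacementOne (d : ℕ) [NeZero d] (a : ZMod d × ZMod d) : Matrix (ZMod d) (ZMod d) ℂ :=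
  tauPhase d ^ (a.1.val * a.2.val) • (shiftMatrix d ^ a.1.val * clockMatrix d ^ a.2.val)

/-- The displacement operator `D_a = D_{a_1} ⊗ ⋯ ⊗ D_{a_n}` of `n` qudits. -/
def displacement {d n : ℕ} [NeZero d] (a : PhaseSpace d n) :
    Matrix (Fin n → ZMod d) (Fin n → ZMod d) ℂ :=
  Matrix.of fun x y => ∏ i, displacementOne d (a i) (x i) (y i)

/-- The symplectic form `[a, b] = ∑ i, (a_{i,2} b_{i,1} - a_{i,1} b_{i,2})` with values in `ℤ_d`. -/
def symplecticForm {d n : ℕ} (a b : PhaseSpace d n) : ZMod d :=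
  ∑ i, ((a i).2 * (b i).1 - (a i).1 * (b i).2)

/-- A subgroup of phase space is totally isotropic if the symplectic form vanishes on it. -/
def IsTotallyIsotropic {d n : ℕ} (S : AddSubgroup (PhaseSpace d n)) : Prop :=
  ∀ a ∈ S, ∀ b ∈ S, symplecticForm a b = 0

/-- The stabilizer codespace of `S` and a homomorphism `f : S → ℤ_d`: the common `+1` eigenspace of
the operators `ω^{f(a)} D_a`, `a ∈ S`. -/
def stabilizerCodespace {d n : ℕ} [NeZero d] (S : AddSubgroup (PhaseSpace d n))
    (f : S →+ ZMod d) : Submodule ℂ (QuditSpace d n) :=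
  ⨅ a : S, LinearMap.ker
    (Matrix.toEuclideanLin (omegaPhase d ^ (f a).val • displacement (a : PhaseSpace d n)) - 1)

/-- The symplectic complement `S^⊥`. -/
def symplecticPerp {d n : ℕ} (S : AddSubgroup (PhaseSpace d n)) : Set (PhaseSpace d n) :=
  {a | ∀ b ∈ S, symplecticForm a b = 0}

/-- The set `A_S` of all `a` with `2 a ∈ S` and `a ∈ S^⊥`. -/
def halfPerpSet {d n : ℕ} (S : AddSubgroup (PhaseSpace d n)) : Set (PhaseSpace d n) :=
  {a | 2 • a ∈ S ∧ a ∈ symplecticPerp S}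

/-- The density operator `|ψ⟩⟨ψ|`. -/
def pureState {d n : ℕ} (ψ : QuditSpace d n) :
    Matrix (Fin n → ZMod d) (Fin n → ZMod d) ℂ :=
  Matrix.vecMulVec (fun x => ψ x) (fun x => star (ψ x))

/-- The linear stabilizer entropy `M(ψ) = 1 - d^{-n} ∑_a |Tr (D_a† |ψ⟩⟨ψ|)|⁴` of the pure state
given by a unit vector `ψ`. -/
def stabilizerEntropy {d n : ℕ} [NeZero d] (ψ : QuditSpace d n) : ℝ :=
  1 - 1 / (d : ℝ) ^ n *
    ∑ a : PhaseSpace d n, ‖((displacement a)ᴴ * pureState ψ).trace‖ ^ 4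

/-- The average stabilizer entropy gap of an isometric embedding `V` of `m` qudits of local
dimension `D` into `n` qudits of local dimension `d`: the average of `M_B(V ψ) - M_S(ψ)` over the
uniform (unitarily invariant) probability distribution on the unit vectors `ψ` of the small space. -/
def aseGap {D m d n : ℕ} [NeZero D] [NeZero d] (V : QuditSpace D m →ₗᵢ[ℂ] QuditSpace d n) : ℝ :=
  ⨍ ψ : Metric.sphere (0 : QuditSpace D m) 1,
    (stabilizerEntropy (V ψ) - stabilizerEntropy (ψ : QuditSpace D m))
      ∂(volume : Measure (QuditSpace D m)).toSphere

end

/-! For `a ∈ S^⊥` the displacement `D_a` preserves the code and induces a unitary logical operator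
on the small space. Comparing traces with the projection `|S|⁻¹ ∑ s, ω^{f(s)} D_s` onto the code
shows that it is traceless unless `a ∈ S`, when it is a phase. Its square is a phase times the
logical operator of `2 a`, which is where `A_S` comes from. For `a ∉ S^⊥` the diagonal matrix
elements of `D_a` on the code vanish.

The moments of `⟨ψ, T ψ⟩` on the sphere for Hermitian `T` are, after diagonalisation, ratios of
Gaussian integrals, i.e. complete homogeneous sums of the eigenvalues. For a traceless unitary `U`,
averaging over Hermitian combinations `w U + w̄ U†` with `w³ = 1` gives, with `N` the dimension,
`E |⟨ψ, U ψ⟩|⁴ = (|tr U²|² + 2 N² + 6 N) / (N (N + 1) (N + 2) (N + 3))`.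
Summing over phase space expresses the average entropy on the code through `|A_S|`. The entropy of
the small space is the case of the trivial subgroup, for which `A` is the 2-torsion of phase space
and has `α` elements.
-/

/-- The complete homogeneous symmetric sum of degree `k` in the values `c i`, `i ∈ s`: the sum of
all monomials of degree `k`, encoded by their exponents, which are supported in `s`. Up to a
constant it is the Gaussian moment of the diagonal form with coefficients `c`. -/
def completeHomogSum {ι R : Type*} [DecidableEq ι] [CommSemiring R] (c : ι → R) (s : Finset ι)
    (k : ℕ) : R :=
  ∑ f ∈ s.piAntidiag k, ∏ i ∈ s, c i ^ f i

lemma completeHomogSum_cons {ι R : Type*} [DecidableEq ι] [CommSemiring R] (c : ι → R)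
    {s : Finset ι} {j : ι} (hj : j ∉ s) (k : ℕ) :
    completeHomogSum c (s.cons j hj) k =
      ∑ p ∈ Finset.HasAntidiagonal.antidiagonal k, c j ^ p.1 * completeHomogSum c s p.2 := by
  rw [completeHomogSum, Finset.piAntidiag_cons hj, Finset.sum_disjiUnion]
  refine Finset.sum_congr rfl fun p _ => ?_
  rw [Finset.sum_map, completeHomogSum, Finset.mul_sum]
  refine Finset.sum_congr rfl fun f hf => ?_
  have hfj : f j = 0 := by
    by_contra h
    exact hj ((Finset.mem_piAntidiag.1 hf).2 j h)
  rw [Finset.prod_cons]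
  congr 1
  · simp [hfj]
  · refine Finset.prod_congr rfl fun i hi => ?_
    have : i ≠ j := fun h => hj (h ▸ hi)
    simp [this]

lemma completeHomogSum_zero {ι R : Type*} [DecidableEq ι] [CommSemiring R] (c : ι → R)
    (s : Finset ι) : completeHomogSum c s 0 = 1 := by
  simp [completeHomogSum]

lemma completeHomogSum_cons_succ {ι R : Type*} [DecidableEq ι] [CommSemiring R] (c : ι → R)
    {s : Finset ι} {j : ι} (hj : j ∉ s) (k : ℕ) :
    completeHomogSum c (s.cons j hj) (k + 1) =
      completeHomogSum c s (k + 1) + c j * completeHomogSum c (s.cons j hj) k := by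
  rw [completeHomogSum_cons, completeHomogSum_cons, Finset.Nat.sum_antidiagonal_succ,
    Finset.mul_sum, pow_zero, one_mul]
  simp only [pow_succ', mul_assoc]

section PowerSums

variable {ι R : Type*} [DecidableEq ι] [CommRing R] (c : ι → R) (s : Finset ι)

lemma completeHomogSum_one : completeHomogSum c s 1 = ∑ i ∈ s, c i := by
  induction s using Finset.cons_induction with
  | empty => simp [completeHomogSum]
  | cons j s hj ih =>
    rw [completeHomogSum_cons_succ, completeHomogSum_zero, Finset.sum_cons]
    linear_combination ih

lemma two_mul_completeHomogSum_two :
    2 * completeHomogSum c s 2 = (∑ i ∈ s, c i) ^ 2 + ∑ i ∈ s, c i ^ 2 := by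
  induction s using Finset.cons_induction with
  | empty => simp [completeHomogSum]
  | cons j s hj ih =>
    simp only [completeHomogSum_cons_succ c hj 1, completeHomogSum_one, Finset.sum_cons]
    linear_combination ih

lemma six_mul_completeHomogSum_three :
    6 * completeHomogSum c s 3 = (∑ i ∈ s, c i) ^ 3 + 3 * (∑ i ∈ s, c i) * ∑ i ∈ s, c i ^ 2
      + 2 * ∑ i ∈ s, c i ^ 3 := by
  induction s using Finset.cons_induction with
  | empty => simp [completeHomogSum]
  | cons j s hj ih =>
    have h2 := two_mul_completeHomogSum_two c (s.cons j hj)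
    simp only [completeHomogSum_cons_succ c hj 2, Finset.sum_cons] at h2 ⊢
    linear_combination ih + 3 * c j * h2

lemma twentyFour_mul_completeHomogSum_four :
    24 * completeHomogSum c s 4 = (∑ i ∈ s, c i) ^ 4 + 6 * (∑ i ∈ s, c i) ^ 2 * ∑ i ∈ s, c i ^ 2
      + 3 * (∑ i ∈ s, c i ^ 2) ^ 2 + 8 * (∑ i ∈ s, c i) * ∑ i ∈ s, c i ^ 3
      + 6 * ∑ i ∈ s, c i ^ 4 := by
  induction s using Finset.cons_induction with
  | empty => simp [completeHomogSum]
  | cons j s hj ih =>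
    have h3 := six_mul_completeHomogSum_three c (s.cons j hj)
    simp only [completeHomogSum_cons_succ c hj 3, Finset.sum_cons] at h3 ⊢
    linear_combination ih + 4 * c j * h3

end PowerSums

lemma completeHomogSum_one_pos {ι : Type*} [DecidableEq ι] {s : Finset ι} (hs : s.Nonempty)
    (k : ℕ) : 0 < completeHomogSum (fun _ : ι => (1 : ℝ)) s k := by
  simp only [completeHomogSum, one_pow, Finset.prod_const_one, Finset.sum_const, nsmul_eq_mul,
    mul_one, Nat.cast_pos, Finset.card_pos]
  obtain ⟨i, hi⟩ := hs
  refine ⟨Pi.single i k, Finset.mem_piAntidiag.2 ⟨by simp [hi], fun j hj => ?_⟩⟩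
  obtain rfl : j = i := not_imp_comm.1 (fun h => Pi.single_eq_of_ne (M := fun _ => ℕ) h k) hj
  exact hi

lemma integral_norm_sq_pow_mul_exp_neg_norm_sq (k : ℕ) :
    ∫ z : ℂ, (‖z‖ ^ 2) ^ k * Real.exp (-‖z‖ ^ 2) = Real.pi * k.factorial := by
  have h := Complex.integral_rpow_mul_exp_neg_rpow (p := 2) (q := 2 * k) (by norm_num)
    (by have : (0 : ℝ) ≤ k := k.cast_nonneg
        linarith)
  have hexponent : ((2 : ℝ) * k + 2) / 2 = k + 1 := by ring
  rw [hexponent, Real.Gamma_nat_eq_factorial] at h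
  rw [← mul_div_cancel_left₀ Real.pi (two_ne_zero (α := ℝ)), ← h]
  refine integral_congr_ae (.of_forall fun z => ?_)
  simp only
  rw [← pow_mul, ← Real.rpow_natCast ‖z‖ (2 * k), ← Real.rpow_natCast ‖z‖ 2]
  push_cast
  rfl

lemma integrable_norm_sq_pow_mul_exp_neg_norm_sq (k : ℕ) :
    Integrable fun z : ℂ => (‖z‖ ^ 2) ^ k * Real.exp (-‖z‖ ^ 2) := by
  refine not_imp_comm.1 integral_undef ?_
  rw [integral_norm_sq_pow_mul_exp_neg_norm_sq]
  positivity

section Gaussian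

variable {ι : Type*} [Fintype ι] [DecidableEq ι]

lemma diagonalForm_pow_mul_exp_eq_sum (c x : ι → ℝ) (k : ℕ) :
    (∑ i, c i * x i) ^ k * Real.exp (-∑ i, x i) =
      ∑ f ∈ Finset.univ.piAntidiag k, (Nat.multinomial Finset.univ f * ∏ i, c i ^ f i) *
        ∏ i, (x i ^ f i * Real.exp (-x i)) := by
  rw [Finset.sum_pow_eq_sum_piAntidiag, Finset.sum_mul]
  refine Finset.sum_congr rfl fun f _ => ?_
  rw [← Finset.sum_neg_distrib, Real.exp_sum, Finset.prod_mul_distrib]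
  simp only [mul_pow, Finset.prod_mul_distrib]
  ring

lemma integral_diagonalForm_pow_mul_exp_neg (c : ι → ℝ) (k : ℕ) :
    ∫ z : ι → ℂ, (∑ i, c i * ‖z i‖ ^ 2) ^ k * Real.exp (-∑ i, ‖z i‖ ^ 2) =
      Real.pi ^ Fintype.card ι * k.factorial * completeHomogSum c Finset.univ k := by
  simp only [diagonalForm_pow_mul_exp_eq_sum]
  rw [integral_finsetSum]
  · rw [completeHomogSum, Finset.mul_sum]
    refine Finset.sum_congr rfl fun f hf => ?_
    rw [integral_const_mul, integral_fintype_prod_volume_eq_prod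
      (f := fun (i : ι) (z : ℂ) => (‖z‖ ^ 2) ^ f i * Real.exp (-‖z‖ ^ 2))]
    simp only [integral_norm_sq_pow_mul_exp_neg_norm_sq, Finset.prod_mul_distrib,
      Finset.prod_const, Finset.card_univ]
    have hmultinomial :
        (∏ i, ((f i).factorial : ℝ)) * Nat.multinomial Finset.univ f = k.factorial := by
      have := Nat.multinomial_spec Finset.univ f
      rw [(Finset.mem_piAntidiag.1 hf).1] at this
      exact_mod_cast this
    rw [← hmultinomial]
    ring
  · exact fun f _ => (Integrable.fintype_prod (f := fun (i : ι) (z : ℂ) =>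
      (‖z‖ ^ 2) ^ f i * Real.exp (-‖z‖ ^ 2)) fun i =>
        integrable_norm_sq_pow_mul_exp_neg_norm_sq (f i)).const_mul _

end Gaussian

section PolarCoordinates

variable {E : Type*} [NormedAddCommGroup E] [NormedSpace ℝ E] [MeasurableSpace E] [BorelSpace E]
  [FiniteDimensional ℝ E] (μ : Measure E) [μ.IsAddHaarMeasure]

lemma integral_homogeneous_mul_radial [Nontrivial E] {p : ℕ} {f : E → ℝ}
    (hf : ∀ r > 0, ∀ x, f (r • x) = r ^ p * f x) (g : ℝ → ℝ) :
    ∫ x, f x * g ‖x‖ ∂μ = (∫ x : Metric.sphere (0 : E) 1, f x ∂μ.toSphere) *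
      ∫ r : Set.Ioi (0 : ℝ), (r : ℝ) ^ p * g r
        ∂(Measure.volumeIoiPow (Module.finrank ℝ E - 1)) := by
  calc
    ∫ x, f x * g ‖x‖ ∂μ
        = ∫ x : ({(0)}ᶜ : Set E), f x.1 * g ‖x.1‖ ∂(μ.comap (↑)) := by
      rw [integral_subtype_comap (measurableSet_singleton _).compl
        fun x ↦ f x * g ‖x‖, restrict_compl_singleton]
    _ = ∫ x : Metric.sphere (0 : E) 1 × Set.Ioi (0 : ℝ), f x.1 * ((x.2 : ℝ) ^ p * g x.2)
          ∂μ.toSphere.prod (.volumeIoiPow (Module.finrank ℝ E - 1)) := by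
      rw [← μ.measurePreserving_homeomorphUnitSphereProd.integral_comp
        (Homeomorph.measurableEmbedding _)]
      refine integral_congr_ae (.of_forall fun x => ?_)
      have hx : 0 < ‖(x : E)‖ := norm_pos_iff.2 x.2
      simp only [homeomorphUnitSphereProd_apply_snd_coe, homeomorphUnitSphereProd_apply_fst_coe,
        hf _ (inv_pos.2 hx), inv_pow]
      field_simp
    _ = _ := integral_prod_mul (fun x : Metric.sphere (0 : E) 1 => f x)
        (fun r : Set.Ioi (0 : ℝ) => (r : ℝ) ^ p * g r)

lemma integral_homogeneous_mul_radial_eq_average_mul [Nontrivial E] {p : ℕ} {f : E → ℝ}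
    (hf : ∀ r > 0, ∀ x, f (r • x) = r ^ p * f x) (g : ℝ → ℝ) :
    ∫ x, f x * g ‖x‖ ∂μ =
      (⨍ x : Metric.sphere (0 : E) 1, f x ∂μ.toSphere) * ∫ x, ‖x‖ ^ p * g ‖x‖ ∂μ := by
  have hnorm : ∀ r > 0, ∀ x : E, ‖r • x‖ ^ p = r ^ p * ‖x‖ ^ p := fun r hr x => by
    rw [norm_smul_of_nonneg hr.le, mul_pow]
  rw [integral_homogeneous_mul_radial μ hf, integral_homogeneous_mul_radial μ hnorm,
    ← measure_smul_average]
  simp only [norm_eq_of_mem_sphere, one_pow, integral_const, smul_eq_mul, mul_one]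
  ring

lemma exists_integral_comp_continuousLinearEquiv_eq_mul {F : Type*} [NormedAddCommGroup F]
    [NormedSpace ℝ F] [MeasurableSpace F] [BorelSpace F] (L : E ≃L[ℝ] F) (ν : Measure F)
    [ν.IsAddHaarMeasure] :
    ∃ κ : ℝ, κ ≠ 0 ∧ ∀ f : F → ℝ, ∫ x, f (L x) ∂μ = κ * ∫ y, f y ∂ν := by
  have : FiniteDimensional ℝ F := L.toLinearEquiv.finiteDimensional
  have := L.isAddHaarMeasure_map μ
  obtain ⟨κ, hκ, hmap⟩ : ∃ κ : NNReal, 0 < κ ∧ μ.map L = κ • ν :=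
    ⟨_, Measure.addHaarScalarFactor_pos_of_isAddHaarMeasure _ _,
      Measure.isAddLeftInvariant_eq_smul _ _⟩
  refine ⟨κ, mod_cast hκ.ne', fun f => ?_⟩
  calc
    ∫ x, f (L x) ∂μ = ∫ y, f y ∂(μ.map L) :=
      (L.toHomeomorph.measurableEmbedding.integral_map f).symm
    _ = κ * ∫ y, f y ∂ν := by
      rw [hmap, integral_smul_nnreal_measure, NNReal.smul_def, smul_eq_mul]

end PolarCoordinates

lemma trace_add_pow_four {R M : Type*} [CommRing R] [AddCommGroup M] [Module R M]
    (A B : M →ₗ[R] M) :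
    LinearMap.trace R M ((A + B) ^ 4) = LinearMap.trace R M (A ^ 4) +
      4 * LinearMap.trace R M (A ^ 3 * B) + 4 * LinearMap.trace R M (A ^ 2 * B ^ 2) +
      2 * LinearMap.trace R M (A * B * A * B) + 4 * LinearMap.trace R M (A * B ^ 3) +
      LinearMap.trace R M (B ^ 4) := by
  have hcomm := LinearMap.trace_mul_comm R (M := M)
  have hA3B := hcomm B (A * A * A)
  have hA2BA := hcomm (A * A * B) A
  have hABA2 := hcomm (A * B) (A * A)
  have hAB3 := hcomm (B * B * B) A
  have hB2AB := hcomm (B * B) (A * B)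
  have hBAB2 := hcomm B (A * B * B)
  have hB2A2 := hcomm (B * B) (A * A)
  have hAB2A := hcomm (A * B * B) A
  have hBA2B := hcomm B (A * A * B)
  have hBABA := hcomm B (A * B * A)
  simp only [pow_succ, pow_zero, one_mul, add_mul, mul_add, map_add, ← mul_assoc] at *
  linear_combination hA3B + hA2BA + hABA2 + hAB3 + hB2AB + hBAB2 + hB2A2 + hAB2A + hBA2B + hBABA

lemma trace_adjoint {𝕜 E : Type*} [RCLike 𝕜] [NormedAddCommGroup E] [InnerProductSpace 𝕜 E]
    [FiniteDimensional 𝕜 E] (T : E →ₗ[𝕜] E) :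
    LinearMap.trace 𝕜 E T.adjoint = (starRingEnd 𝕜) (LinearMap.trace 𝕜 E T) := by
  simp only [LinearMap.trace_eq_sum_inner _ (stdOrthonormalBasis 𝕜 E), map_sum,
    LinearMap.adjoint_inner_right, inner_conj_symm]

section SymmetricOperators

variable {𝕜 E : Type*} [RCLike 𝕜] [NormedAddCommGroup E] [InnerProductSpace 𝕜 E]
  [FiniteDimensional 𝕜 E] {T : E →ₗ[𝕜] E} (hT : T.IsSymmetric)

include hT

lemma trace_pow_eq_sum_eigenvalues_pow (k : ℕ) :
    LinearMap.trace 𝕜 E (T ^ k) = ((∑ i, hT.eigenvalues rfl i ^ k : ℝ) : 𝕜) := by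
  rw [LinearMap.trace_eq_sum_inner _ (hT.eigenvectorBasis rfl)]
  push_cast
  refine Finset.sum_congr rfl fun i _ => ?_
  rw [(hT.hasEigenvector_eigenvectorBasis rfl i).pow_apply, inner_smul_right,
    inner_self_eq_norm_sq_to_K, OrthonormalBasis.norm_eq_one]
  simp

lemma inner_apply_self_eq_sum_eigenvalues (x : E) :
    inner 𝕜 x (T x) =
      ((∑ i, hT.eigenvalues rfl i * ‖(hT.eigenvectorBasis rfl).repr x i‖ ^ 2 : ℝ) : 𝕜) := by
  rw [← (hT.eigenvectorBasis rfl).repr.inner_map_map, PiLp.inner_apply]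
  push_cast
  refine Finset.sum_congr rfl fun i _ => ?_
  rw [hT.eigenvectorBasis_apply_self_apply, RCLike.inner_apply, mul_assoc, RCLike.mul_conj]

end SymmetricOperators

lemma pow_mul_conj_of_isPrimitiveRoot {ζ : ℂ} {k : ℕ} (hζ : IsPrimitiveRoot ζ k) (hk : k ≠ 0)
    (j : ℕ) : ζ ^ j * (starRingEnd ℂ) (ζ ^ j) = 1 := by
  rw [Complex.mul_conj', norm_pow, hζ.norm'_eq_one hk, one_pow, Complex.ofReal_one, one_pow]

lemma sum_cubeRoots_quartic {ζ : ℂ} (hζ : IsPrimitiveRoot ζ 3) (c₄ c₂ c₀ d₂ d₄ : ℂ) :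
    ∑ j ∈ Finset.range 3, (c₄ * (ζ ^ j) ^ 4 + c₂ * (ζ ^ j) ^ 2 + c₀ +
      d₂ * (starRingEnd ℂ) (ζ ^ j) ^ 2 + d₄ * (starRingEnd ℂ) (ζ ^ j) ^ 4) = 3 * c₀ := by
  have hcube : ζ ^ 3 = 1 := hζ.pow_eq_one
  have hgeom : 1 + ζ + ζ ^ 2 = 0 := by
    simpa [Finset.sum_range_succ] using hζ.geom_sum_eq_zero (by norm_num)
  have hconj : (starRingEnd ℂ) ζ = ζ ^ 2 := by
    rw [← Complex.inv_eq_conj (hζ.norm'_eq_one (by norm_num))]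
    exact inv_eq_of_mul_eq_one_right (by rw [← pow_succ', hcube])
  have hfour : ζ ^ 4 = ζ := by rw [pow_succ, hcube, one_mul]
  have height : ζ ^ 8 = ζ ^ 2 := by rw [show 8 = 4 * 2 from rfl, pow_mul, hfour]
  have hsixteen : ζ ^ 16 = ζ := by rw [show 16 = 4 * 4 from rfl, pow_mul, hfour, hfour]
  simp only [Finset.sum_range_succ, Finset.sum_range_zero, map_pow, hconj, ← pow_mul]
  norm_num [hfour, height, hsixteen]
  linear_combination (c₄ + c₂ + d₂ + d₄) * hgeom

section HermitianCombination

variable {E : Type*} [NormedAddCommGroup E] [InnerProductSpace ℂ E] [FiniteDimensional ℂ E]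

/-- The Hermitian operator `w T + w̄ T†`, through which moments of a general operator `T` are
expressed by moments of Hermitian ones. -/
noncomputable def hermitianCombination (w : ℂ) (T : E →ₗ[ℂ] E) : E →ₗ[ℂ] E :=
  w • T + (starRingEnd ℂ) w • T.adjoint

section Traces

variable (w : ℂ) (T : E →ₗ[ℂ] E)

lemma isSymmetric_hermitianCombination : (hermitianCombination w T).IsSymmetric := by
  intro x y
  simp only [hermitianCombination, LinearMap.add_apply, LinearMap.smul_apply, inner_add_left,
    inner_add_right, inner_smul_left, inner_smul_right, Complex.conj_conj,
    LinearMap.adjoint_inner_left, LinearMap.adjoint_inner_right]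
  ring

lemma inner_hermitianCombination_apply_self (x : E) :
    inner ℂ x (hermitianCombination w T x) =
      w * inner ℂ x (T x) + (starRingEnd ℂ) w * (starRingEnd ℂ) (inner ℂ x (T x)) := by
  simp only [hermitianCombination, LinearMap.add_apply, LinearMap.smul_apply, inner_add_right,
    inner_smul_right, LinearMap.adjoint_inner_right, inner_conj_symm]

lemma trace_hermitianCombination :
    LinearMap.trace ℂ E (hermitianCombination w T) =
      w * LinearMap.trace ℂ E T + (starRingEnd ℂ) w * (starRingEnd ℂ) (LinearMap.trace ℂ E T) := by
  rw [hermitianCombination, map_add, map_smul, map_smul, trace_adjoint, smul_eq_mul, smul_eq_mul]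

variable {w} (hw : w * (starRingEnd ℂ) w = 1)

include hw

lemma trace_hermitianCombination_sq :
    LinearMap.trace ℂ E (hermitianCombination w T ^ 2) =
      w ^ 2 * LinearMap.trace ℂ E (T ^ 2) + 2 * LinearMap.trace ℂ E (T * T.adjoint) +
        (starRingEnd ℂ) w ^ 2 * LinearMap.trace ℂ E (T.adjoint ^ 2) := by
  have hcomm := LinearMap.trace_mul_comm ℂ T.adjoint T
  simp only [hermitianCombination, pow_two, add_mul, mul_add, smul_mul_smul_comm, map_add,
    map_smul, smul_eq_mul, hcomm]
  linear_combination 2 * LinearMap.trace ℂ E (T * T.adjoint) * hw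

lemma trace_hermitianCombination_pow_four :
    LinearMap.trace ℂ E (hermitianCombination w T ^ 4) =
      w ^ 4 * LinearMap.trace ℂ E (T ^ 4) +
        4 * w ^ 2 * LinearMap.trace ℂ E (T ^ 3 * T.adjoint) +
        (4 * LinearMap.trace ℂ E (T ^ 2 * T.adjoint ^ 2) +
          2 * LinearMap.trace ℂ E (T * T.adjoint * T * T.adjoint)) +
        4 * (starRingEnd ℂ) w ^ 2 * LinearMap.trace ℂ E (T * T.adjoint ^ 3) +
        (starRingEnd ℂ) w ^ 4 * LinearMap.trace ℂ E (T.adjoint ^ 4) := by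
  simp only [hermitianCombination, trace_add_pow_four, smul_pow, smul_mul_smul_comm, map_smul,
    smul_eq_mul]
  linear_combination
    (4 * w ^ 2 * LinearMap.trace ℂ E (T ^ 3 * T.adjoint) +
      4 * (starRingEnd ℂ) w ^ 2 * LinearMap.trace ℂ E (T * T.adjoint ^ 3) +
      (4 * LinearMap.trace ℂ E (T ^ 2 * T.adjoint ^ 2) +
        2 * LinearMap.trace ℂ E (T * T.adjoint * T * T.adjoint)) *
        (w * (starRingEnd ℂ) w + 1)) * hw

end Traces

/- Averaging over the three phases `w` with `w³ = 1` keeps exactly the terms with equally many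
factors `T` and `T†`, which reduces the absolute moment of `T` to moments of Hermitian operators. -/
lemma norm_inner_pow_four_eq_sum_cubeRoots {ζ : ℂ} (hζ : IsPrimitiveRoot ζ 3) (T : E →ₗ[ℂ] E)
    (x : E) :
    ‖inner ℂ x (T x)‖ ^ 4 =
      18⁻¹ * ∑ j ∈ Finset.range 3, (inner ℂ x (hermitianCombination (ζ ^ j) T x)).re ^ 4 := by
  set u := inner ℂ x (T x)
  have hunit := pow_mul_conj_of_isPrimitiveRoot hζ (by norm_num)
  have hre (j : ℕ) : ((inner ℂ x (hermitianCombination (ζ ^ j) T x)).re : ℂ) =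
      ζ ^ j * u + (starRingEnd ℂ) (ζ ^ j) * (starRingEnd ℂ) u := by
    rw [← inner_hermitianCombination_apply_self]
    exact (isSymmetric_hermitianCombination _ T).coe_re_inner_self_apply x
  have hnorm : ((‖u‖ ^ 4 : ℝ) : ℂ) = (u * (starRingEnd ℂ) u) ^ 2 := by
    rw [Complex.mul_conj']
    push_cast
    ring
  apply Complex.ofReal_injective
  have hsum := sum_cubeRoots_quartic hζ (u ^ 4) (4 * u ^ 3 * (starRingEnd ℂ) u)
    (6 * (u * (starRingEnd ℂ) u) ^ 2) (4 * u * (starRingEnd ℂ) u ^ 3) ((starRingEnd ℂ) u ^ 4)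
  rw [hnorm]
  push_cast
  simp only [hre]
  rw [← mul_right_inj' (by norm_num : (18 : ℂ) ≠ 0), mul_inv_cancel_left₀ (by norm_num)]
  refine Eq.trans (by linear_combination) (hsum.symm.trans (Finset.sum_congr rfl fun j _ => ?_))
  linear_combination -(4 * u ^ 3 * (starRingEnd ℂ) u * (ζ ^ j) ^ 2 +
    4 * u * (starRingEnd ℂ) u ^ 3 * (starRingEnd ℂ) (ζ ^ j) ^ 2 +
    6 * (u * (starRingEnd ℂ) u) ^ 2 * (ζ ^ j * (starRingEnd ℂ) (ζ ^ j) + 1)) * hunit j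

end HermitianCombination

section SphereAverage

variable {E : Type*} [NormedAddCommGroup E] [InnerProductSpace ℂ E] [FiniteDimensional ℂ E]
  [MeasurableSpace E] [BorelSpace E] (μ : Measure E) [μ.IsAddHaarMeasure]

section DiagonalForm

variable {ι : Type*} [Fintype ι] [DecidableEq ι] (b : OrthonormalBasis ι ℂ E)

lemma exists_integral_diagonalForm_pow_mul_exp_neg_eq_mul (k : ℕ) :
    ∃ κ : ℝ, κ ≠ 0 ∧ ∀ c : ι → ℝ,
      ∫ x, (∑ i, c i * ‖b.repr x i‖ ^ 2) ^ k * Real.exp (-‖x‖ ^ 2) ∂μ =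
        κ * completeHomogSum c Finset.univ k := by
  have : FiniteDimensional ℝ E := FiniteDimensional.trans ℝ ℂ E
  let L : E ≃L[ℝ] (ι → ℂ) :=
    ((b.repr.toLinearEquiv.trans
      (EuclideanSpace.equiv ι ℂ).toLinearEquiv).restrictScalars ℝ).toContinuousLinearEquiv
  have hnorm (x : E) : ‖x‖ ^ 2 = ∑ i, ‖L x i‖ ^ 2 := by
    rw [← b.repr.norm_map, EuclideanSpace.norm_sq_eq]
    rfl
  obtain ⟨κ, hκ, hL⟩ := exists_integral_comp_continuousLinearEquiv_eq_mul μ L volume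
  refine ⟨κ * (Real.pi ^ Fintype.card ι * k.factorial), by positivity, fun c => ?_⟩
  simp only [hnorm]
  rw [mul_assoc, ← integral_diagonalForm_pow_mul_exp_neg, ← hL]
  rfl

/- Averages over the sphere are ratios of Gaussian integrals, since the radial part of a homogeneous
integrand factors out. -/
lemma average_sphere_diagonalForm_pow [Nontrivial E] (c : ι → ℝ) (k : ℕ) :
    ⨍ ψ : Metric.sphere (0 : E) 1, (∑ i, c i * ‖b.repr (ψ : E) i‖ ^ 2) ^ k ∂μ.toSphere =
      completeHomogSum c Finset.univ k / completeHomogSum (fun _ : ι => (1 : ℝ)) Finset.univ k := by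
  have : FiniteDimensional ℝ E := FiniteDimensional.trans ℝ ℂ E
  have : Nonempty ι := b.toBasis.index_nonempty
  have hhomog : ∀ r > (0 : ℝ), ∀ x : E, (∑ i, c i * ‖b.repr (r • x) i‖ ^ 2) ^ k =
      r ^ (2 * k) * (∑ i, c i * ‖b.repr x i‖ ^ 2) ^ k := fun r hr x => by
    rw [pow_mul, ← mul_pow, Finset.mul_sum]
    congr 1
    refine Finset.sum_congr rfl fun i _ => ?_
    have : b.repr (r • x) i = (r : ℂ) * b.repr x i := by
      rw [← Complex.coe_smul, map_smul, PiLp.smul_apply, smul_eq_mul]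
    rw [this, norm_mul, Complex.norm_real, Real.norm_of_nonneg hr.le]
    ring
  have hsq (x : E) : (∑ i, 1 * ‖b.repr x i‖ ^ 2) ^ k = ‖x‖ ^ (2 * k) := by
    rw [← b.repr.norm_map, pow_mul, EuclideanSpace.norm_sq_eq]
    simp only [one_mul]
  obtain ⟨κ, hκ, hintegral⟩ := exists_integral_diagonalForm_pow_mul_exp_neg_eq_mul μ b k
  have hratio := integral_homogeneous_mul_radial_eq_average_mul μ
    (f := fun x => (∑ i, c i * ‖b.repr x i‖ ^ 2) ^ k) hhomog fun r => Real.exp (-r ^ 2)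
  simp only [← hsq, hintegral] at hratio
  rw [eq_div_iff (completeHomogSum_one_pos Finset.univ_nonempty k).ne']
  refine mul_left_cancel₀ hκ ?_
  linear_combination -hratio

end DiagonalForm

lemma average_sphere_symmetric_pow_four [Nontrivial E] {T : E →ₗ[ℂ] E} (hT : T.IsSymmetric) :
    ((⨍ ψ : Metric.sphere (0 : E) 1, (inner ℂ (ψ : E) (T ψ)).re ^ 4 ∂μ.toSphere : ℝ) : ℂ) =
      (LinearMap.trace ℂ E T ^ 4 + 6 * LinearMap.trace ℂ E T ^ 2 * LinearMap.trace ℂ E (T ^ 2) +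
        3 * LinearMap.trace ℂ E (T ^ 2) ^ 2 +
        8 * LinearMap.trace ℂ E T * LinearMap.trace ℂ E (T ^ 3) +
        6 * LinearMap.trace ℂ E (T ^ 4)) /
        (Module.finrank ℂ E * (Module.finrank ℂ E + 1) * (Module.finrank ℂ E + 2) *
          (Module.finrank ℂ E + 3)) := by
  simp only [inner_apply_self_eq_sum_eigenvalues hT, Complex.coe_algebraMap, Complex.ofReal_re,
    hT.trace_eq_sum_eigenvalues rfl, trace_pow_eq_sum_eigenvalues_pow hT]
  rw [average_sphere_diagonalForm_pow, ← mul_div_mul_left _ _ (by norm_num : (24 : ℝ) ≠ 0),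
    twentyFour_mul_completeHomogSum_four, twentyFour_mul_completeHomogSum_four]
  simp only [one_pow, Finset.sum_const, Finset.card_univ, Fintype.card_fin, nsmul_eq_mul, mul_one]
  push_cast
  congr 1
  ring

lemma integrable_sphere_of_continuous {F : Type*} [NormedAddCommGroup F] {f : E → F}
    (hf : Continuous f) :
    Integrable (fun ψ : Metric.sphere (0 : E) 1 => f ψ) μ.toSphere := by
  have : FiniteDimensional ℝ E := FiniteDimensional.trans ℝ ℂ E
  exact (hf.comp continuous_subtype_val).integrable_of_hasCompactSupport
    (HasCompactSupport.of_compactSpace _)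

lemma average_sphere_norm_inner_pow_four_eq_sum {ζ : ℂ} (hζ : IsPrimitiveRoot ζ 3)
    (T : E →ₗ[ℂ] E) :
    ⨍ ψ : Metric.sphere (0 : E) 1, ‖inner ℂ (ψ : E) (T ψ)‖ ^ 4 ∂μ.toSphere =
      18⁻¹ * ∑ j ∈ Finset.range 3, ⨍ ψ : Metric.sphere (0 : E) 1,
        (inner ℂ (ψ : E) (hermitianCombination (ζ ^ j) T ψ)).re ^ 4 ∂μ.toSphere := by
  have hcont (H : E →ₗ[ℂ] E) : Continuous fun x : E => (inner ℂ x (H x)).re ^ 4 := by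
    have := H.continuous_of_finiteDimensional
    fun_prop
  simp only [norm_inner_pow_four_eq_sum_cubeRoots hζ, average_eq, smul_eq_mul]
  rw [integral_const_mul, integral_finsetSum _ fun j _ =>
    integrable_sphere_of_continuous μ (hcont _), mul_left_comm, Finset.mul_sum]

lemma average_sphere_norm_inner_pow_four [Nontrivial E] {T : E →ₗ[ℂ] E}
    (htr : LinearMap.trace ℂ E T = 0) :
    ((⨍ ψ : Metric.sphere (0 : E) 1, ‖inner ℂ (ψ : E) (T ψ)‖ ^ 4 ∂μ.toSphere : ℝ) : ℂ) =
      (LinearMap.trace ℂ E (T ^ 2) * LinearMap.trace ℂ E (T.adjoint ^ 2) +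
        2 * LinearMap.trace ℂ E (T * T.adjoint) ^ 2 +
        4 * LinearMap.trace ℂ E (T ^ 2 * T.adjoint ^ 2) +
        2 * LinearMap.trace ℂ E (T * T.adjoint * T * T.adjoint)) /
        (Module.finrank ℂ E * (Module.finrank ℂ E + 1) * (Module.finrank ℂ E + 2) *
          (Module.finrank ℂ E + 3)) := by
  have hζ := Complex.isPrimitiveRoot_exp 3 (by norm_num)
  set ζ := Complex.exp (2 * Real.pi * Complex.I / (3 : ℕ))
  have hunit := pow_mul_conj_of_isPrimitiveRoot hζ (by norm_num)
  have hzero (j : ℕ) : LinearMap.trace ℂ E (hermitianCombination (ζ ^ j) T) = 0 := by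
    rw [trace_hermitianCombination, htr, map_zero, mul_zero, mul_zero, add_zero]
  set p := LinearMap.trace ℂ E (T ^ 2)
  set p' := LinearMap.trace ℂ E (T.adjoint ^ 2)
  set r := LinearMap.trace ℂ E (T * T.adjoint)
  set s := 4 * LinearMap.trace ℂ E (T ^ 2 * T.adjoint ^ 2) +
    2 * LinearMap.trace ℂ E (T * T.adjoint * T * T.adjoint)
  have hsum := sum_cubeRoots_quartic hζ (3 * p ^ 2 + 6 * LinearMap.trace ℂ E (T ^ 4))
    (12 * p * r + 24 * LinearMap.trace ℂ E (T ^ 3 * T.adjoint))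
    (6 * p * p' + 12 * r ^ 2 + 6 * s)
    (12 * p' * r + 24 * LinearMap.trace ℂ E (T * T.adjoint ^ 3))
    (3 * p' ^ 2 + 6 * LinearMap.trace ℂ E (T.adjoint ^ 4))
  rw [average_sphere_norm_inner_pow_four_eq_sum μ hζ]
  push_cast
  simp only [average_sphere_symmetric_pow_four μ (isSymmetric_hermitianCombination _ T), hzero]
  rw [← Finset.sum_div, ← mul_div_assoc, add_assoc]
  congr 1
  rw [← mul_right_inj' (by norm_num : (18 : ℂ) ≠ 0), mul_inv_cancel_left₀ (by norm_num)]
  refine Eq.trans (Finset.sum_congr rfl fun j _ => ?_) (hsum.trans (by ring))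
  rw [trace_hermitianCombination_sq T (hunit j), trace_hermitianCombination_pow_four T (hunit j)]
  linear_combination 6 * p * p' * (ζ ^ j * (starRingEnd ℂ) (ζ ^ j) + 1) * hunit j

lemma average_sphere_norm_inner_unitary_pow_four [Nontrivial E] {U : E →ₗ[ℂ] E}
    (hU : U.adjoint * U = 1) (htr : LinearMap.trace ℂ E U = 0) :
    ⨍ ψ : Metric.sphere (0 : E) 1, ‖inner ℂ (ψ : E) (U ψ)‖ ^ 4 ∂μ.toSphere =
      (‖LinearMap.trace ℂ E (U ^ 2)‖ ^ 2 + 2 * (Module.finrank ℂ E : ℝ) ^ 2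
          + 6 * Module.finrank ℂ E) /
        (Module.finrank ℂ E * (Module.finrank ℂ E + 1) * (Module.finrank ℂ E + 2) *
          (Module.finrank ℂ E + 3)) := by
  have hU' : U * U.adjoint = 1 := mul_eq_one_comm.1 hU
  have hsq : U ^ 2 * U.adjoint ^ 2 = 1 := by
    rw [pow_two, pow_two, mul_assoc, ← mul_assoc U U.adjoint, hU', one_mul, hU']
  have hconj : LinearMap.trace ℂ E (U.adjoint ^ 2) =
      (starRingEnd ℂ) (LinearMap.trace ℂ E (U ^ 2)) := by
    rw [← trace_adjoint]
    exact congrArg _ (star_pow U 2).symm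
  apply Complex.ofReal_injective
  rw [average_sphere_norm_inner_pow_four μ htr, hconj, hsq, hU', one_mul, hU',
    LinearMap.trace_one, Complex.mul_conj']
  push_cast
  ring

end SphereAverage

lemma stdAddChar_sum_eq_prod {d : ℕ} [NeZero d] {ι : Type*} (s : Finset ι) (k : ι → ZMod d) :
    ZMod.stdAddChar (∑ i ∈ s, k i) = ∏ i ∈ s, ZMod.stdAddChar (k i) :=
  map_prod ZMod.stdAddChar.toMonoidHom (fun i => Multiplicative.ofAdd (k i)) s

lemma sum_stdAddChar_comp_eq_zero {d : ℕ} [NeZero d] {G : Type*} [AddCommGroup G] [Fintype G]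
    {φ : G →+ ZMod d} (hφ : φ ≠ 0) : ∑ g, ZMod.stdAddChar (φ g) = 0 := by
  refine (AddChar.sum_eq_zero_iff_ne_zero
    (ψ := (ZMod.stdAddChar (N := d)).compAddMonoidHom φ)).2 fun h => hφ ?_
  ext g
  apply ZMod.injective_stdAddChar
  rw [AddMonoidHom.zero_apply, AddChar.map_zero_eq_one]
  exact DFunLike.congr_fun h g

lemma sum_indicator_const {α R : Type*} [Fintype α] [Semiring R] (A : Set α) (c : R) :
    ∑ a, A.indicator (fun _ => c) a = A.ncard * c := by
  classical
  simp only [Set.indicator_apply]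
  rw [← Finset.sum_filter, Finset.sum_const, nsmul_eq_mul, ← Set.ncard_coe_finset]
  simp

section SymplecticForm

variable {d n : ℕ}

lemma symplecticForm_add_left (a b c : PhaseSpace d n) :
    symplecticForm (a + b) c = symplecticForm a c + symplecticForm b c := by
  simp only [symplecticForm, ← Finset.sum_add_distrib, Pi.add_apply, Prod.fst_add, Prod.snd_add]
  exact Finset.sum_congr rfl fun i _ => by ring

lemma symplecticForm_add_right (a b c : PhaseSpace d n) :
    symplecticForm a (b + c) = symplecticForm a b + symplecticForm a c := by
  simp only [symplecticForm, ← Finset.sum_add_distrib, Pi.add_apply, Prod.fst_add, Prod.snd_add]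
  exact Finset.sum_congr rfl fun i _ => by ring

/-- The symplectic form as a biadditive map, whose partial applications are the homomorphisms
entering the character sums over phase space. -/
def symplecticHom : PhaseSpace d n →+ PhaseSpace d n →+ ZMod d :=
  AddMonoidHom.mk' (fun a => AddMonoidHom.mk' (symplecticForm a) (symplecticForm_add_right a))
    fun a b => AddMonoidHom.ext (symplecticForm_add_left a b)

lemma symplecticHom_apply (a b : PhaseSpace d n) : symplecticHom a b = symplecticForm a b := rfl

lemma symplecticHom_flip_ne_zero {s : PhaseSpace d n} (hs : s ≠ 0) : symplecticHom.flip s ≠ 0 := by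
  obtain ⟨i, hi⟩ := Function.ne_iff.1 hs
  have hsingle (p : ZMod d × ZMod d) :
      symplecticHom.flip s (Pi.single i p) = p.2 * (s i).1 - p.1 * (s i).2 := by
    rw [AddMonoidHom.flip_apply, symplecticHom_apply, symplecticForm, Finset.sum_eq_single i]
    · simp
    · intro j _ hj
      simp [hj]
    · simp
  intro h
  simp only [h, AddMonoidHom.zero_apply] at hsingle
  exact hi (Prod.ext (by simpa using (hsingle (0, 1)).symm) (by simpa using (hsingle (1, 0)).symm))

lemma nsmul_mem_symplecticPerp {S : AddSubgroup (PhaseSpace d n)} {a : PhaseSpace d n}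
    (ha : a ∈ symplecticPerp S) (k : ℕ) : k • a ∈ symplecticPerp S := fun s hs => by
  rw [← symplecticHom_apply, map_nsmul, AddMonoidHom.nsmul_apply, symplecticHom_apply, ha s hs,
    nsmul_zero]

lemma sum_stdAddChar_symplecticForm_of_ne_zero [NeZero d] {s : PhaseSpace d n} (hs : s ≠ 0) :
    ∑ a, ZMod.stdAddChar (symplecticForm a s) = 0 :=
  sum_stdAddChar_comp_eq_zero (φ := symplecticHom.flip s) (symplecticHom_flip_ne_zero hs)

lemma sum_subgroup_stdAddChar_symplecticForm [NeZero d] (S : AddSubgroup (PhaseSpace d n))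
    [Fintype S] (a : PhaseSpace d n) :
    ∑ s : S, ZMod.stdAddChar (symplecticForm a s) =
      (symplecticPerp S).indicator (fun _ => (Nat.card S : ℂ)) a := by
  by_cases ha : a ∈ symplecticPerp S
  · have hzero (s : S) : symplecticForm a s = 0 := ha s s.2
    simp [hzero, ha]
  · rw [Set.indicator_of_notMem ha]
    refine sum_stdAddChar_comp_eq_zero (φ := (symplecticHom a).comp S.subtype) fun h => ha ?_
    exact fun s hs => DFunLike.congr_fun h ⟨s, hs⟩

lemma card_mul_ncard_symplecticPerp [NeZero d] (S : AddSubgroup (PhaseSpace d n)) :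
    Nat.card S * (symplecticPerp S).ncard = (d ^ n) ^ 2 := by
  classical
  have hsum : ∑ a : PhaseSpace d n, ∑ s : S, ZMod.stdAddChar (symplecticForm a s) =
      ((d ^ n) ^ 2 : ℕ) := by
    rw [Finset.sum_comm, Finset.sum_eq_single (0 : S)]
    · simp [symplecticForm, ZMod.card, ← sq, ← pow_mul, mul_comm]
    · exact fun s _ hs => sum_stdAddChar_symplecticForm_of_ne_zero (by simpa using hs)
    · simp
  simp only [sum_subgroup_stdAddChar_symplecticForm, sum_indicator_const] at hsum
  rw [mul_comm]
  exact_mod_cast hsum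

end SymplecticForm

section Weyl

variable {d n : ℕ}

/-- The translation part `(a_{1,1}, …, a_{n,1})` of a phase space point, the exponents of `X`. -/
def PhaseSpace.position (a : PhaseSpace d n) : Fin n → ZMod d := fun i => (a i).1

/-- The modulation part `(a_{1,2}, …, a_{n,2})` of a phase space point, the exponents of `Z`. -/
def PhaseSpace.momentum (a : PhaseSpace d n) : Fin n → ZMod d := fun i => (a i).2

lemma symplecticForm_eq_dotProduct (a b : PhaseSpace d n) :
    symplecticForm a b = a.momentum ⬝ᵥ b.position - b.momentum ⬝ᵥ a.position := by
  simp [symplecticForm, dotProduct, PhaseSpace.momentum, PhaseSpace.position, mul_comm]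

lemma norm_tauPhase : ‖tauPhase d‖ = 1 := by
  have h : (Real.pi * Complex.I / d : ℂ) = ((Real.pi / d : ℝ) : ℂ) * Complex.I := by
    push_cast
    ring
  rw [tauPhase, norm_neg, h, Complex.norm_exp_ofReal_mul_I]

/-- The phase `∏ i, τ ^ (a_{i,1} a_{i,2})` of a displacement operator. -/
noncomputable def displacementPhase (a : PhaseSpace d n) : ℂ :=
  ∏ i, tauPhase d ^ ((a i).1.val * (a i).2.val)

lemma norm_displacementPhase (a : PhaseSpace d n) : ‖displacementPhase a‖ = 1 := by
  simp [displacementPhase, norm_prod, norm_tauPhase]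

lemma displacementPhase_ne_zero (a : PhaseSpace d n) : displacementPhase a ≠ 0 := by
  rw [← norm_ne_zero_iff, norm_displacementPhase]
  exact one_ne_zero

variable [NeZero d]

lemma omegaPhase_pow (k : ℕ) : omegaPhase d ^ k = ZMod.stdAddChar (k : ZMod d) := by
  have h := ZMod.stdAddChar_coe (N := d) (k : ℤ)
  rw [Int.cast_natCast] at h
  rw [h, omegaPhase, ← Complex.exp_nat_mul]
  congr 1
  push_cast
  ring

lemma shiftMatrix_pow (k : ℕ) :
    shiftMatrix d ^ k = Matrix.of fun j l => if j = l + (k : ZMod d) then 1 else 0 := by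
  induction k with
  | zero =>
    ext j l
    simp [Matrix.one_apply]
  | succ k ih =>
    ext j l
    rw [pow_succ, ih, Matrix.mul_apply, Finset.sum_eq_single (l + 1)]
    · simp [shiftMatrix, add_assoc, add_comm (1 : ZMod d)]
    · intro x _ hx
      simp [shiftMatrix, hx]
    · simp

lemma displacementOne_apply (a : ZMod d × ZMod d) (j l : ZMod d) :
    displacementOne d a j l = if j = l + a.1 then
      tauPhase d ^ (a.1.val * a.2.val) * ZMod.stdAddChar (a.2 * l) else 0 := by
  have hclock : (fun k : ZMod d => omegaPhase d ^ k.val) ^ a.2.val =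
      fun k => ZMod.stdAddChar (a.2 * k) := by
    ext k
    rw [Pi.pow_apply, ← pow_mul, omegaPhase_pow, Nat.cast_mul, ZMod.natCast_zmod_val,
      ZMod.natCast_zmod_val, mul_comm]
  rw [displacementOne, Matrix.smul_apply, shiftMatrix_pow, clockMatrix, Matrix.diagonal_pow,
    Matrix.mul_diagonal, hclock]
  simp only [Matrix.of_apply, ZMod.natCast_zmod_val, smul_eq_mul]
  split_ifs <;> simp

lemma displacement_apply (a : PhaseSpace d n) (x y : Fin n → ZMod d) :
    displacement a x y = if x = y + a.position then
      displacementPhase a * ZMod.stdAddChar (a.momentum ⬝ᵥ y) else 0 := by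
  simp only [displacement, Matrix.of_apply, displacementOne_apply]
  split_ifs with h
  · have hx (i : Fin n) : x i = y i + (a i).1 := congrFun h i
    simp only [hx, if_true, Finset.prod_mul_distrib, displacementPhase, dotProduct,
      stdAddChar_sum_eq_prod, PhaseSpace.momentum]
  · obtain ⟨i, hi⟩ := Function.ne_iff.1 h
    exact Finset.prod_eq_zero (Finset.mem_univ i) (if_neg hi)

/-- The displacement operator `D_a` as a linear map. -/
noncomputable def weylOperator (a : PhaseSpace d n) : QuditSpace d n →ₗ[ℂ] QuditSpace d n :=
  Matrix.toEuclideanLin (displacement a)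

lemma weylOperator_apply (a : PhaseSpace d n) (v : QuditSpace d n) (x : Fin n → ZMod d) :
    weylOperator a v x = displacementPhase a *
      ZMod.stdAddChar (a.momentum ⬝ᵥ (x - a.position)) * v (x - a.position) := by
  rw [weylOperator, Matrix.ofLp_toLpLin, Matrix.toLin'_apply, Matrix.mulVec, dotProduct,
    Finset.sum_eq_single (x - a.position)]
  · simp [displacement_apply]
  · intro y _ hy
    rw [displacement_apply, if_neg, zero_mul]
    rintro rfl
    simp at hy
  · simp

lemma weylOperator_zero : weylOperator (0 : PhaseSpace d n) = 1 := by
  have hphase : displacementPhase (0 : PhaseSpace d n) = 1 := by simp [displacementPhase]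
  have hpos : (0 : PhaseSpace d n).position = 0 := rfl
  have hmom : (0 : PhaseSpace d n).momentum = 0 := rfl
  ext v x
  simp [weylOperator_apply, hphase, hpos, hmom]

/-- The unimodular factor in the composition law `D_a D_b = weylCocycle a b • D_{a + b}`. -/
noncomputable def weylCocycle (a b : PhaseSpace d n) : ℂ :=
  displacementPhase a * displacementPhase b * (displacementPhase (a + b))⁻¹ *
    ZMod.stdAddChar (a.momentum ⬝ᵥ b.position)

lemma norm_weylCocycle (a b : PhaseSpace d n) : ‖weylCocycle a b‖ = 1 := by
  simp [weylCocycle, norm_displacementPhase]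

lemma weylOperator_mul (a b : PhaseSpace d n) :
    weylOperator a * weylOperator b = weylCocycle a b • weylOperator (a + b) := by
  ext v x
  have hpos : (a + b).position = a.position + b.position := rfl
  have hmom : (a + b).momentum = a.momentum + b.momentum := rfl
  have hsplit : a.momentum ⬝ᵥ (x - a.position) =
      a.momentum ⬝ᵥ b.position + a.momentum ⬝ᵥ (x - (a.position + b.position)) := by
    rw [← dotProduct_add]
    congr 1
    abel
  have hphase := displacementPhase_ne_zero (a + b)
  simp only [Module.End.mul_apply, LinearMap.smul_apply, PiLp.smul_apply, weylOperator_apply,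
    weylCocycle, hpos, hmom, hsplit, add_dotProduct, AddChar.map_add_eq_mul, sub_sub, smul_eq_mul]
  field_simp

lemma weylOperator_mul_comm (a b : PhaseSpace d n) : weylOperator a * weylOperator b =
    ZMod.stdAddChar (symplecticForm a b) • (weylOperator b * weylOperator a) := by
  have hform : a.momentum ⬝ᵥ b.position = symplecticForm a b + b.momentum ⬝ᵥ a.position := by
    rw [symplecticForm_eq_dotProduct]
    ring
  rw [weylOperator_mul, weylOperator_mul, smul_smul, add_comm b a, weylCocycle, weylCocycle, hform,
    AddChar.map_add_eq_mul, add_comm b a]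
  congr 1
  ring

lemma norm_weylOperator_apply (a : PhaseSpace d n) (v : QuditSpace d n) :
    ‖weylOperator a v‖ = ‖v‖ := by
  rw [← sq_eq_sq₀ (norm_nonneg _) (norm_nonneg _), EuclideanSpace.norm_sq_eq,
    EuclideanSpace.norm_sq_eq]
  simp only [weylOperator_apply, norm_mul, norm_displacementPhase, AddChar.norm_apply, one_mul]
  exact (Equiv.subRight a.position).sum_comp fun x => ‖v x‖ ^ 2

lemma inner_weylOperator_weylOperator (a : PhaseSpace d n) (v w : QuditSpace d n) :
    inner ℂ (weylOperator a v) (weylOperator a w) = inner ℂ v w :=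
  LinearIsometry.inner_map_map ⟨weylOperator a, norm_weylOperator_apply a⟩ v w

lemma trace_weylOperator_of_ne_zero {a : PhaseSpace d n} (ha : a ≠ 0) :
    LinearMap.trace ℂ _ (weylOperator a) = 0 := by
  rw [LinearMap.trace_eq_sum_inner _ (EuclideanSpace.basisFun _ ℂ)]
  simp only [EuclideanSpace.basisFun_apply, EuclideanSpace.inner_single_left, weylOperator_apply,
    map_one, one_mul, PiLp.single_apply]
  by_cases hpos : a.position = 0
  · simp only [hpos, sub_zero, if_true, mul_one, ← Finset.mul_sum]
    refine mul_eq_zero_of_right _ (sum_stdAddChar_comp_eq_zero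
      (φ := AddMonoidHom.mk' (a.momentum ⬝ᵥ ·) (dotProduct_add _)) fun h => ha ?_)
    refine funext fun i => Prod.ext (congrFun hpos i) ?_
    simpa [PhaseSpace.momentum] using DFunLike.congr_fun h (Pi.single i 1)
  · refine Finset.sum_eq_zero fun x _ => ?_
    rw [if_neg (by simpa using hpos), mul_zero]

lemma norm_trace_displacement_mul_pureState (a : PhaseSpace d n) (ψ : QuditSpace d n) :
    ‖((displacement a)ᴴ * pureState ψ).trace‖ = ‖inner ℂ ψ (weylOperator a ψ)‖ := by
  have h : inner ℂ (weylOperator a ψ) ψ = star (displacement a *ᵥ ψ) ⬝ᵥ (ψ : _ → ℂ) := by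
    rw [weylOperator, EuclideanSpace.inner_eq_star_dotProduct, dotProduct_comm]
    rfl
  rw [norm_inner_symm, h, pureState, Matrix.mul_vecMulVec, Matrix.trace_vecMulVec,
    Matrix.star_mulVec, dotProduct_comm, ← Matrix.dotProduct_mulVec]
  rfl

lemma stabilizerEntropy_eq_sum_inner (ψ : QuditSpace d n) :
    stabilizerEntropy ψ =
      1 - 1 / (d : ℝ) ^ n * ∑ a : PhaseSpace d n, ‖inner ℂ ψ (weylOperator a ψ)‖ ^ 4 := by
  simp only [stabilizerEntropy, norm_trace_displacement_mul_pureState]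

lemma continuous_stabilizerEntropy : Continuous (stabilizerEntropy : QuditSpace d n → ℝ) := by
  have hW (a : PhaseSpace d n) : Continuous (weylOperator a) :=
    (weylOperator a).continuous_of_finiteDimensional
  rw [funext stabilizerEntropy_eq_sum_inner]
  fun_prop

end Weyl

section StabilizerOperators

variable {d n : ℕ} [NeZero d] {S : AddSubgroup (PhaseSpace d n)}

/-- The operator `ω^{f(s)} D_s`, whose fixed vectors for all `s ∈ S` make up the code. -/
noncomputable def stabilizerOperator (f : S →+ ZMod d) (s : S) :
    QuditSpace d n →ₗ[ℂ] QuditSpace d n :=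
  ZMod.stdAddChar (f s) • weylOperator (s : PhaseSpace d n)

variable {f : S →+ ZMod d}

lemma mem_stabilizerCodespace_iff {v : QuditSpace d n} :
    v ∈ stabilizerCodespace S f ↔ ∀ s, stabilizerOperator f s v = v := by
  simp [stabilizerCodespace, stabilizerOperator, weylOperator, Submodule.mem_iInf,
    LinearMap.mem_ker, sub_eq_zero, omegaPhase_pow]

lemma stabilizerOperator_mul (s t : S) :
    stabilizerOperator f s * stabilizerOperator f t =
      weylCocycle (s : PhaseSpace d n) t • stabilizerOperator f (s + t) := by
  simp only [stabilizerOperator, smul_mul_smul_comm, weylOperator_mul, smul_smul, map_add,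
    AddChar.map_add_eq_mul, AddSubgroup.coe_add, mul_comm]

lemma weylOperator_mul_stabilizerOperator (a : PhaseSpace d n) (s : S) :
    weylOperator a * stabilizerOperator f s =
      ZMod.stdAddChar (symplecticForm a s) • (stabilizerOperator f s * weylOperator a) := by
  rw [stabilizerOperator, mul_smul_comm, weylOperator_mul_comm, smul_mul_assoc, smul_comm]

lemma inner_stabilizerOperator_stabilizerOperator (s : S) (v w : QuditSpace d n) :
    inner ℂ (stabilizerOperator f s v) (stabilizerOperator f s w) = inner ℂ v w := by
  rw [stabilizerOperator, LinearMap.smul_apply, LinearMap.smul_apply, inner_smul_left,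
    inner_smul_right, inner_weylOperator_weylOperator, ← mul_assoc, Complex.conj_mul',
    AddChar.norm_apply]
  simp

lemma weylCocycle_eq_one_of_mem_stabilizerCodespace {v : QuditSpace d n}
    (hv : v ∈ stabilizerCodespace S f) (hv0 : v ≠ 0) (s t : S) :
    weylCocycle (s : PhaseSpace d n) t = 1 := by
  rw [mem_stabilizerCodespace_iff] at hv
  have h := DFunLike.congr_fun (stabilizerOperator_mul (f := f) s t) v
  rw [Module.End.mul_apply, LinearMap.smul_apply, hv t, hv s, hv (s + t)] at h
  exact smul_left_injective ℂ hv0 (by simpa using h.symm)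

lemma inner_weylOperator_of_notMem_symplecticPerp {v : QuditSpace d n}
    (hv : v ∈ stabilizerCodespace S f) {a : PhaseSpace d n} (ha : a ∉ symplecticPerp S) :
    inner ℂ v (weylOperator a v) = 0 := by
  rw [mem_stabilizerCodespace_iff] at hv
  obtain ⟨s, hne⟩ : ∃ s : S, symplecticForm a s ≠ 0 := by
    by_contra! h
    exact ha fun s hs => h ⟨s, hs⟩
  have hcomm : weylOperator a v = ZMod.stdAddChar (symplecticForm a s) •
      stabilizerOperator f s (weylOperator a v) := by
    have h := DFunLike.congr_fun (weylOperator_mul_stabilizerOperator (f := f) a s) v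
    rwa [Module.End.mul_apply, hv s] at h
  have hinv : inner ℂ v (stabilizerOperator f s (weylOperator a v)) =
      inner ℂ v (weylOperator a v) := by
    have h := inner_stabilizerOperator_stabilizerOperator (f := f) s v (weylOperator a v)
    rwa [hv s] at h
  have hfix : inner ℂ v (weylOperator a v) = ZMod.stdAddChar (symplecticForm a s) *
      inner ℂ v (weylOperator a v) := by
    conv_lhs => rw [hcomm, inner_smul_right, hinv]
  by_contra h
  refine hne (ZMod.injective_stdAddChar ?_)
  rw [AddChar.map_zero_eq_one]
  exact (mul_right_cancel₀ h ((one_mul _).trans hfix)).symm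

lemma weylOperator_mem_stabilizerCodespace {v : QuditSpace d n}
    (hv : v ∈ stabilizerCodespace S f) {a : PhaseSpace d n} (ha : a ∈ symplecticPerp S) :
    weylOperator a v ∈ stabilizerCodespace S f := by
  rw [mem_stabilizerCodespace_iff] at hv ⊢
  intro s
  have h := DFunLike.congr_fun (weylOperator_mul_stabilizerOperator (f := f) a s) v
  rw [ha s s.2, AddChar.map_zero_eq_one, one_smul, Module.End.mul_apply, hv s] at h
  exact h.symm

lemma weylOperator_apply_of_mem {v : QuditSpace d n} (hv : v ∈ stabilizerCodespace S f) (s : S) :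
    weylOperator (s : PhaseSpace d n) v = ZMod.stdAddChar (-f s) • v := by
  conv_rhs => rw [← mem_stabilizerCodespace_iff.1 hv s]
  rw [stabilizerOperator, LinearMap.smul_apply, smul_smul, ← AddChar.map_add_eq_mul,
    neg_add_cancel, AddChar.map_zero_eq_one, one_smul]

lemma sum_stabilizerOperator_mem_stabilizerCodespace [Fintype S] {v : QuditSpace d n}
    (hv : v ∈ stabilizerCodespace S f) (hv0 : v ≠ 0) (w : QuditSpace d n) :
    ∑ s, stabilizerOperator f s w ∈ stabilizerCodespace S f := by
  rw [mem_stabilizerCodespace_iff]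
  intro s
  have hmul (t : S) : stabilizerOperator f s (stabilizerOperator f t w) =
      stabilizerOperator f (s + t) w := by
    rw [← Module.End.mul_apply, stabilizerOperator_mul,
      weylCocycle_eq_one_of_mem_stabilizerCodespace hv hv0, one_smul]
  simp only [map_sum, hmul]
  exact Equiv.sum_comp (Equiv.addLeft s) fun t => stabilizerOperator f t w

end StabilizerOperators

section LogicalOperators

variable {d n : ℕ} [NeZero d] {S : AddSubgroup (PhaseSpace d n)} {f : S →+ ZMod d}
  {E : Type*} [NormedAddCommGroup E] [InnerProductSpace ℂ E] {V : E →ₗᵢ[ℂ] QuditSpace d n}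

lemma encode_mem_stabilizerCodespace
    (hV : LinearMap.range V.toLinearMap = stabilizerCodespace S f) (x : E) :
    V x ∈ stabilizerCodespace S f :=
  hV ▸ LinearMap.mem_range_self V.toLinearMap x

lemma mem_symplecticPerp_of_mem [Nontrivial E]
    (hV : LinearMap.range V.toLinearMap = stabilizerCodespace S f) {a : PhaseSpace d n}
    (ha : a ∈ S) : a ∈ symplecticPerp S := by
  obtain ⟨x, hx⟩ := exists_ne (0 : E)
  by_contra h
  have hx0 := inner_weylOperator_of_notMem_symplecticPerp (encode_mem_stabilizerCodespace hV x) h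
  rw [weylOperator_apply_of_mem (encode_mem_stabilizerCodespace hV x) ⟨a, ha⟩, inner_smul_right,
    V.inner_map_map, mul_eq_zero, inner_self_eq_zero, ← norm_eq_zero, AddChar.norm_apply] at hx0
  exact hx0.elim one_ne_zero hx

lemma mem_halfPerpSet_of_mem [Nontrivial E]
    (hV : LinearMap.range V.toLinearMap = stabilizerCodespace S f) {a : PhaseSpace d n}
    (ha : a ∈ S) : a ∈ halfPerpSet S :=
  ⟨S.nsmul_mem ha 2, mem_symplecticPerp_of_mem hV ha⟩

variable [FiniteDimensional ℂ E]

/-- The compression `V† D_a V` of a displacement operator to the encoded space. For `a ∈ S^⊥` it is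
the logical operator which `D_a` induces on the code. -/
noncomputable def logicalOperator (V : E →ₗᵢ[ℂ] QuditSpace d n) (a : PhaseSpace d n) :
    E →ₗ[ℂ] E :=
  V.toLinearMap.adjoint ∘ₗ weylOperator a ∘ₗ V.toLinearMap

lemma inner_logicalOperator (a : PhaseSpace d n) (x y : E) :
    inner ℂ x (logicalOperator V a y) = inner ℂ (V x) (weylOperator a (V y)) := by
  rw [logicalOperator, LinearMap.comp_apply, LinearMap.adjoint_inner_right]
  rfl

lemma adjoint_encode_apply (x : E) : V.toLinearMap.adjoint (V x) = x :=
  DFunLike.congr_fun V.adjoint_comp_self' x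

lemma encode_adjoint_apply (hV : LinearMap.range V.toLinearMap = stabilizerCodespace S f)
    {v : QuditSpace d n} (hv : v ∈ stabilizerCodespace S f) : V (V.toLinearMap.adjoint v) = v := by
  rw [← hV] at hv
  obtain ⟨x, rfl⟩ := hv
  exact congrArg V (adjoint_encode_apply x)

lemma encode_logicalOperator (hV : LinearMap.range V.toLinearMap = stabilizerCodespace S f)
    {a : PhaseSpace d n} (ha : a ∈ symplecticPerp S) (x : E) :
    V (logicalOperator V a x) = weylOperator a (V x) :=
  encode_adjoint_apply hV
    (weylOperator_mem_stabilizerCodespace (encode_mem_stabilizerCodespace hV x) ha)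

lemma adjoint_mul_logicalOperator (hV : LinearMap.range V.toLinearMap = stabilizerCodespace S f)
    {a : PhaseSpace d n} (ha : a ∈ symplecticPerp S) :
    (logicalOperator V a).adjoint * logicalOperator V a = 1 := by
  ext x
  refine ext_inner_left ℂ fun y => ?_
  rw [Module.End.mul_apply, LinearMap.adjoint_inner_right, ← V.inner_map_map,
    encode_logicalOperator hV ha, encode_logicalOperator hV ha, inner_weylOperator_weylOperator,
    V.inner_map_map, Module.End.one_apply]

lemma logicalOperator_sq (hV : LinearMap.range V.toLinearMap = stabilizerCodespace S f)
    {a : PhaseSpace d n} (ha : a ∈ symplecticPerp S) :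
    logicalOperator V a ^ 2 = weylCocycle a a • logicalOperator V (2 • a) := by
  ext x
  apply V.injective
  rw [pow_two, Module.End.mul_apply, encode_logicalOperator hV ha, encode_logicalOperator hV ha,
    LinearMap.smul_apply, map_smul, encode_logicalOperator hV (nsmul_mem_symplecticPerp ha 2),
    ← Module.End.mul_apply, weylOperator_mul, two_nsmul, LinearMap.smul_apply]

lemma logicalOperator_of_mem (hV : LinearMap.range V.toLinearMap = stabilizerCodespace S f)
    (s : S) : logicalOperator V (s : PhaseSpace d n) = ZMod.stdAddChar (-f s) • 1 := by
  ext x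
  rw [logicalOperator, LinearMap.comp_apply, LinearMap.comp_apply, LinearIsometry.coe_toLinearMap,
    weylOperator_apply_of_mem (encode_mem_stabilizerCodespace hV x), map_smul, adjoint_encode_apply]
  rfl

lemma norm_trace_logicalOperator_of_mem
    (hV : LinearMap.range V.toLinearMap = stabilizerCodespace S f) {a : PhaseSpace d n}
    (ha : a ∈ S) : ‖LinearMap.trace ℂ E (logicalOperator V a)‖ = Module.finrank ℂ E := by
  rw [logicalOperator_of_mem hV ⟨a, ha⟩, map_smul, LinearMap.trace_one, norm_smul,
    AddChar.norm_apply, one_mul, Complex.norm_natCast]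

lemma sum_stabilizerOperator [Nontrivial E] [Fintype S]
    (hV : LinearMap.range V.toLinearMap = stabilizerCodespace S f) :
    ∑ s, stabilizerOperator f s =
      (Nat.card S : ℂ) • (V.toLinearMap ∘ₗ V.toLinearMap.adjoint) := by
  obtain ⟨x, hx⟩ := exists_ne (0 : E)
  have hVx : V x ≠ 0 := (map_ne_zero_iff V V.injective).2 hx
  have hadj (s : S) (v : QuditSpace d n) :
      V.toLinearMap.adjoint (stabilizerOperator f s v) = V.toLinearMap.adjoint v := by
    refine ext_inner_left ℂ fun y => ?_
    have hy := mem_stabilizerCodespace_iff.1 (encode_mem_stabilizerCodespace hV y) s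
    rw [LinearMap.adjoint_inner_right, LinearMap.adjoint_inner_right,
      LinearIsometry.coe_toLinearMap]
    conv_lhs => rw [← hy, inner_stabilizerOperator_stabilizerOperator]
  ext1 v
  have hmem := sum_stabilizerOperator_mem_stabilizerCodespace
    (encode_mem_stabilizerCodespace hV x) hVx v
  rw [LinearMap.sum_apply, ← encode_adjoint_apply hV hmem]
  simp [hadj, Nat.cast_smul_eq_nsmul]

lemma card_mul_trace_logicalOperator [Nontrivial E] [Fintype S]
    (hV : LinearMap.range V.toLinearMap = stabilizerCodespace S f) (a : PhaseSpace d n) :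
    Nat.card S * LinearMap.trace ℂ E (logicalOperator V a) =
      ∑ s : S, ZMod.stdAddChar (f s) * weylCocycle a s *
        LinearMap.trace ℂ _ (weylOperator (a + (s : PhaseSpace d n))) := by
  calc Nat.card S * LinearMap.trace ℂ E (logicalOperator V a)
      = Nat.card S * LinearMap.trace ℂ _
          (weylOperator a * (V.toLinearMap ∘ₗ V.toLinearMap.adjoint)) := by
        rw [logicalOperator, LinearMap.trace_comp_comm', LinearMap.comp_assoc]
        rfl
    _ = LinearMap.trace ℂ _ (weylOperator a * ∑ s, stabilizerOperator f s) := by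
        rw [sum_stabilizerOperator hV, mul_smul_comm, map_smul, smul_eq_mul]
    _ = _ := by
        simp only [Finset.mul_sum, map_sum, stabilizerOperator, mul_smul_comm, weylOperator_mul,
          smul_smul, map_smul, smul_eq_mul]

lemma trace_logicalOperator_of_notMem [Nontrivial E]
    (hV : LinearMap.range V.toLinearMap = stabilizerCodespace S f) {a : PhaseSpace d n}
    (ha : a ∉ S) : LinearMap.trace ℂ E (logicalOperator V a) = 0 := by
  classical
  have h := card_mul_trace_logicalOperator hV a
  rw [Finset.sum_eq_zero, mul_eq_zero] at h
  · exact h.resolve_left (Nat.cast_ne_zero.2 Nat.card_pos.ne')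
  · intro s _
    rw [trace_weylOperator_of_ne_zero, mul_zero]
    intro h0
    exact ha (eq_neg_of_add_eq_zero_left h0 ▸ S.neg_mem s.2)

lemma finrank_mul_card [Nontrivial E]
    (hV : LinearMap.range V.toLinearMap = stabilizerCodespace S f) :
    Module.finrank ℂ E * Nat.card S = d ^ n := by
  classical
  have hone : logicalOperator V 0 = (1 : E →ₗ[ℂ] E) := by
    rw [logicalOperator, weylOperator_zero]
    exact V.adjoint_comp_self'
  have hcocycle : weylCocycle (0 : PhaseSpace d n) 0 = 1 := by
    have hmom : (0 : PhaseSpace d n).momentum = 0 := rfl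
    simp [weylCocycle, displacementPhase, hmom]
  have h := card_mul_trace_logicalOperator hV 0
  rw [hone, LinearMap.trace_one, Finset.sum_eq_single (0 : S)] at h
  · simp only [map_zero, AddSubgroup.coe_zero, add_zero, hcocycle, weylOperator_zero,
      LinearMap.trace_one, AddChar.map_zero_eq_one, one_mul, finrank_euclideanSpace,
      Fintype.card_fun, ZMod.card, Fintype.card_fin] at h
    rw [mul_comm]
    exact_mod_cast h
  · intro s _ hs
    rw [trace_weylOperator_of_ne_zero (by simpa using hs), mul_zero]
  · simp

end LogicalOperators

section CodeAverage

variable {d n : ℕ} [NeZero d] {S : AddSubgroup (PhaseSpace d n)} {f : S →+ ZMod d}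
  {E : Type*} [NormedAddCommGroup E] [InnerProductSpace ℂ E] [FiniteDimensional ℂ E]
  [MeasurableSpace E] [BorelSpace E] (μ : Measure E) [μ.IsAddHaarMeasure]
  {V : E →ₗᵢ[ℂ] QuditSpace d n}

lemma integrable_sphere_inner_weylOperator_pow_four (a : PhaseSpace d n) :
    Integrable (fun ψ : Metric.sphere (0 : E) 1 =>
      ‖inner ℂ (V ψ) (weylOperator a (V ψ))‖ ^ 4) μ.toSphere := by
  have hW : Continuous (weylOperator a) := (weylOperator a).continuous_of_finiteDimensional
  have hV : Continuous V := V.continuous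
  exact integrable_sphere_of_continuous μ
    (f := fun ψ => ‖inner ℂ (V ψ) (weylOperator a (V ψ))‖ ^ 4) (by fun_prop)

variable [Nontrivial E]

lemma average_sphere_stabilizerEntropy_eq_sum :
    ⨍ ψ : Metric.sphere (0 : E) 1, stabilizerEntropy (V ψ) ∂μ.toSphere =
      1 - 1 / (d : ℝ) ^ n * ∑ a : PhaseSpace d n, ⨍ ψ : Metric.sphere (0 : E) 1,
        ‖inner ℂ (V ψ) (weylOperator a (V ψ))‖ ^ 4 ∂μ.toSphere := by
  have : NeZero μ.toSphere := ⟨Measure.toSphere_ne_zero μ⟩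
  have hmoment := integrable_sphere_inner_weylOperator_pow_four μ (V := V)
  simp only [stabilizerEntropy_eq_sum_inner, average_eq, smul_eq_mul]
  rw [integral_sub (integrable_const _) ((integrable_finsetSum _ fun a _ => hmoment a).const_mul _),
    integral_const_mul, integral_finsetSum _ fun a _ => hmoment a, integral_const, mul_sub,
    smul_eq_mul, mul_one, inv_mul_cancel₀ measureReal_univ_ne_zero, ← Finset.mul_sum,
    mul_left_comm]

lemma average_sphere_inner_weylOperator_pow_four_of_mem
    (hV : LinearMap.range V.toLinearMap = stabilizerCodespace S f) {a : PhaseSpace d n}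
    (ha : a ∈ S) :
    ⨍ ψ : Metric.sphere (0 : E) 1, ‖inner ℂ (V ψ) (weylOperator a (V ψ))‖ ^ 4 ∂μ.toSphere = 1 := by
  have : NeZero μ.toSphere := ⟨Measure.toSphere_ne_zero μ⟩
  have hone (ψ : Metric.sphere (0 : E) 1) : ‖inner ℂ (V ψ) (weylOperator a (V ψ))‖ ^ 4 = 1 := by
    rw [weylOperator_apply_of_mem (encode_mem_stabilizerCodespace hV ψ) ⟨a, ha⟩, inner_smul_right,
      V.inner_map_map, inner_self_eq_norm_sq_to_K, norm_mul, AddChar.norm_apply]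
    simp
  simp only [hone, average_const]

lemma average_sphere_inner_weylOperator_pow_four_of_mem_symplecticPerp
    (hV : LinearMap.range V.toLinearMap = stabilizerCodespace S f) {a : PhaseSpace d n}
    (ha : a ∈ symplecticPerp S) (haS : a ∉ S) {N : ℝ} (hN : N = Module.finrank ℂ E) :
    ⨍ ψ : Metric.sphere (0 : E) 1, ‖inner ℂ (V ψ) (weylOperator a (V ψ))‖ ^ 4 ∂μ.toSphere =
      (‖LinearMap.trace ℂ E (logicalOperator V (2 • a))‖ ^ 2 + 2 * N ^ 2 + 6 * N) /
        (N * (N + 1) * (N + 2) * (N + 3)) := by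
  simp only [← inner_logicalOperator]
  rw [average_sphere_norm_inner_unitary_pow_four μ (adjoint_mul_logicalOperator hV ha)
    (trace_logicalOperator_of_notMem hV haS), logicalOperator_sq hV ha, map_smul, norm_smul,
    norm_weylCocycle, one_mul, hN]

lemma average_sphere_inner_weylOperator_pow_four
    (hV : LinearMap.range V.toLinearMap = stabilizerCodespace S f) {N : ℝ}
    (hN : N = Module.finrank ℂ E) (a : PhaseSpace d n) :
    ⨍ ψ : Metric.sphere (0 : E) 1, ‖inner ℂ (V ψ) (weylOperator a (V ψ))‖ ^ 4 ∂μ.toSphere =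
      (S : Set (PhaseSpace d n)).indicator (fun _ => 1 - 3 / ((N + 1) * (N + 3))) a +
      (symplecticPerp S).indicator (fun _ => 2 / ((N + 1) * (N + 2))) a +
      (halfPerpSet S).indicator (fun _ => N / ((N + 1) * (N + 2) * (N + 3))) a := by
  have hNpos : 0 < N := hN ▸ Nat.cast_pos.2 Module.finrank_pos
  by_cases hS : a ∈ S
  · have hA := mem_halfPerpSet_of_mem hV hS
    rw [average_sphere_inner_weylOperator_pow_four_of_mem μ hV hS, Set.indicator_of_mem hA,
      Set.indicator_of_mem hA.2, Set.indicator_of_mem (SetLike.mem_coe.2 hS)]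
    field_simp
    ring
  rw [Set.indicator_of_notMem (mt SetLike.mem_coe.1 hS), zero_add]
  by_cases hP : a ∈ symplecticPerp S
  · rw [average_sphere_inner_weylOperator_pow_four_of_mem_symplecticPerp μ hV hP hS hN,
      Set.indicator_of_mem hP]
    by_cases h2 : 2 • a ∈ S
    · have hA : a ∈ halfPerpSet S := ⟨h2, hP⟩
      rw [norm_trace_logicalOperator_of_mem hV h2, Set.indicator_of_mem hA, ← hN]
      field_simp
      ring
    · have hA : a ∉ halfPerpSet S := fun h => h2 h.1
      rw [trace_logicalOperator_of_notMem hV h2, Set.indicator_of_notMem hA, norm_zero]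
      field_simp
      ring
  · have hA : a ∉ halfPerpSet S := fun h => hP h.2
    rw [Set.indicator_of_notMem hP, Set.indicator_of_notMem hA]
    simp [inner_weylOperator_of_notMem_symplecticPerp (encode_mem_stabilizerCodespace hV _) hP]

lemma average_sphere_stabilizerEntropy
    (hV : LinearMap.range V.toLinearMap = stabilizerCodespace S f) {N : ℝ}
    (hN : N = Module.finrank ℂ E) :
    ⨍ ψ : Metric.sphere (0 : E) 1, stabilizerEntropy (V ψ) ∂μ.toSphere =
      (N - 1) / (N + 2) - ((halfPerpSet S).ncard * N - (d : ℝ) ^ n) /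
        ((d : ℝ) ^ n * (N + 1) * (N + 2) * (N + 3)) := by
  have hNpos : 0 < N := hN ▸ Nat.cast_pos.2 Module.finrank_pos
  have hcard : N * Nat.card S = (d : ℝ) ^ n := by
    rw [hN]
    exact_mod_cast finrank_mul_card hV
  have hSpos : (0 : ℝ) < Nat.card S := Nat.cast_pos.2 Nat.card_pos
  have hperp : ((symplecticPerp S).ncard : ℝ) = N ^ 2 * Nat.card S := by
    have h : (Nat.card S : ℝ) * (symplecticPerp S).ncard = ((d : ℝ) ^ n) ^ 2 := by
      exact_mod_cast card_mul_ncard_symplecticPerp S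
    refine mul_left_cancel₀ hSpos.ne' ?_
    rw [h, ← hcard]
    ring
  rw [average_sphere_stabilizerEntropy_eq_sum]
  simp only [average_sphere_inner_weylOperator_pow_four μ hV hN, Finset.sum_add_distrib,
    sum_indicator_const]
  rw [hperp, ← Nat.card_coe_set_eq, SetLike.coe_sort_coe, ← hcard]
  field_simp
  ring

end CodeAverage

section TrivialCode

variable {D m : ℕ}

lemma stabilizerCodespace_bot [NeZero D] :
    stabilizerCodespace (⊥ : AddSubgroup (PhaseSpace D m)) 0 = ⊤ := by
  refine eq_top_iff.2 fun v _ => mem_stabilizerCodespace_iff.2 fun s => ?_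
  have hs : (s : PhaseSpace D m) = 0 := AddSubgroup.mem_bot.1 s.2
  simp [stabilizerOperator, hs, weylOperator_zero]

lemma halfPerpSet_bot :
    halfPerpSet (⊥ : AddSubgroup (PhaseSpace D m)) = {a | 2 • a = 0} := by
  ext a
  simp only [halfPerpSet, symplecticPerp, AddSubgroup.mem_bot, Set.mem_ofPred_eq, forall_eq,
    and_iff_left_iff_imp]
  exact fun _ => map_zero (symplecticHom a)

lemma ncard_nsmul_eq_zero_phaseSpace [NeZero D] (k : ℕ) :
    {a : PhaseSpace D m | k • a = 0}.ncard = (D.gcd k ^ 2) ^ m := by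
  have hset : {a : PhaseSpace D m | k • a = 0} = Set.univ.pi fun _ =>
      ((nsmulAddMonoidHom k : ZMod D →+ ZMod D).ker ×ˢ (nsmulAddMonoidHom k).ker : Set _) := by
    ext a
    simp [funext_iff, Prod.ext_iff]
  have hker : ((nsmulAddMonoidHom k : ZMod D →+ ZMod D).ker : Set (ZMod D)).ncard = D.gcd k := by
    rw [← Nat.card_coe_set_eq, SetLike.coe_sort_coe, IsAddCyclic.card_nsmulAddMonoidHom_ker,
      Nat.card_zmod]
  rw [hset, ← Nat.card_coe_set_eq, Nat.card_congr (Equiv.Set.univPi _), Nat.card_fun,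
    Nat.card_coe_set_eq, Set.ncard_prod, hker, Nat.card_fin, sq]

lemma ncard_halfPerpSet_bot [NeZero D] :
    (halfPerpSet (⊥ : AddSubgroup (PhaseSpace D m))).ncard = (D.gcd 2 ^ 2) ^ m := by
  rw [halfPerpSet_bot, ncard_nsmul_eq_zero_phaseSpace]

lemma ncard_halfPerpSet_bot_of_odd [NeZero D] (h : Odd (D ^ m)) :
    (halfPerpSet (⊥ : AddSubgroup (PhaseSpace D m))).ncard = 1 := by
  rw [ncard_halfPerpSet_bot, ← pow_mul, mul_comm, pow_mul]
  rcases Nat.eq_zero_or_pos m with rfl | hm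
  · simp
  · rw [(Nat.coprime_two_right.2 ((Nat.odd_pow_iff hm.ne').1 h) : D.gcd 2 = 1), one_pow, one_pow]

lemma ncard_halfPerpSet_bot_of_even [NeZero D] (h : Even D) :
    (halfPerpSet (⊥ : AddSubgroup (PhaseSpace D m))).ncard = 4 ^ m := by
  rw [ncard_halfPerpSet_bot, Nat.gcd_eq_right h.two_dvd]
  norm_num

lemma average_sphere_stabilizerEntropy_quditSpace [NeZero D] :
    ⨍ ψ : Metric.sphere (0 : QuditSpace D m) 1, stabilizerEntropy (ψ : QuditSpace D m)
        ∂(volume : Measure (QuditSpace D m)).toSphere =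
      ((D : ℝ) ^ m - 1) / ((D : ℝ) ^ m + 2) -
        ((halfPerpSet (⊥ : AddSubgroup (PhaseSpace D m))).ncard * (D : ℝ) ^ m - (D : ℝ) ^ m) /
          ((D : ℝ) ^ m * ((D : ℝ) ^ m + 1) * ((D : ℝ) ^ m + 2) * ((D : ℝ) ^ m + 3)) := by
  have hid : LinearMap.range (LinearIsometry.id (R := ℂ) (E := QuditSpace D m)).toLinearMap =
      stabilizerCodespace (⊥ : AddSubgroup (PhaseSpace D m)) 0 := by
    rw [stabilizerCodespace_bot]
    exact LinearMap.range_id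
  exact average_sphere_stabilizerEntropy volume hid (N := D ^ m) (by simp [ZMod.card])

lemma aseGap_eq_sub {d n : ℕ} [NeZero D] [NeZero d] (V : QuditSpace D m →ₗᵢ[ℂ] QuditSpace d n) :
    aseGap V =
      (⨍ ψ : Metric.sphere (0 : QuditSpace D m) 1, stabilizerEntropy (V ψ)
        ∂(volume : Measure (QuditSpace D m)).toSphere) -
      ⨍ ψ : Metric.sphere (0 : QuditSpace D m) 1, stabilizerEntropy (ψ : QuditSpace D m)
        ∂(volume : Measure (QuditSpace D m)).toSphere := by
  have hV : Continuous fun ψ => stabilizerEntropy (V ψ) :=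
    continuous_stabilizerEntropy.comp V.continuous
  rw [aseGap, average_eq, average_eq, average_eq, ← smul_sub, ← integral_sub
    (integrable_sphere_of_continuous volume hV)
    (integrable_sphere_of_continuous volume continuous_stabilizerEntropy)]

end TrivialCode

theorem theorem2_general (d n : ℕ) [NeZero d] (S : AddSubgroup (PhaseSpace d n))
    (f : S →+ ZMod d) (D m : ℕ) [NeZero D] (V : QuditSpace D m →ₗᵢ[ℂ] QuditSpace d n)
    (hV : LinearMap.range V.toLinearMap = stabilizerCodespace S f) :
    D ^ m * Nat.card S = d ^ n ∧
    ∀ α : ℝ,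
      ((Odd (D ^ m) ∧ α = 1) ∨
        (Even D ∧ m = 1 ∧ α = 4) ∨
        (D = 2 ∧ α = ((D : ℝ) ^ m) ^ 2) ∨
        (Even D ∧ α = 4 ^ m)) →
      aseGap V =
        (α * (d : ℝ) ^ n - ((halfPerpSet S).ncard : ℝ) * (D : ℝ) ^ m) /
          ((d : ℝ) ^ n * ((D : ℝ) ^ m + 1) * ((D : ℝ) ^ m + 2) * ((D : ℝ) ^ m + 3)) := by
  have hfin : Module.finrank ℂ (QuditSpace D m) = D ^ m := by simp [ZMod.card]
  refine ⟨hfin ▸ finrank_mul_card hV, fun α hα => ?_⟩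
  have hcount : ((halfPerpSet (⊥ : AddSubgroup (PhaseSpace D m))).ncard : ℝ) = α := by
    rcases hα with ⟨hodd, rfl⟩ | ⟨heven, rfl, rfl⟩ | ⟨rfl, rfl⟩ | ⟨heven, rfl⟩
    · simp [ncard_halfPerpSet_bot_of_odd hodd]
    · simp [ncard_halfPerpSet_bot_of_even heven]
    · rw [ncard_halfPerpSet_bot_of_even even_two, ← pow_mul, mul_comm, pow_mul]
      norm_num
    · simp [ncard_halfPerpSet_bot_of_even heven]
  have hD : (0 : ℝ) < D ^ m := pow_pos (Nat.cast_pos.2 (NeZero.pos D)) m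
  have hd : (0 : ℝ) < d ^ n := pow_pos (Nat.cast_pos.2 (NeZero.pos d)) n
  rw [aseGap_eq_sub, average_sphere_stabilizerEntropy volume hV (N := D ^ m) (by simp [hfin]),
    average_sphere_stabilizerEntropy_quditSpace, hcount]
  field_simp
  ring

theorem theorem2 (d n : ℕ) [NeZero d] (S : AddSubgroup (PhaseSpace d n))
    (hS : IsTotallyIsotropic S) (D m : ℕ) [NeZero D]
    (V : QuditSpace D m →ₗᵢ[ℂ] QuditSpace d n)
    (hV : LinearMap.range V.toLinearMap = stabilizerCodespace S 0) :
    D ^ m * Nat.card S = d ^ n ∧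
    ∀ α : ℝ,
      ((Odd (D ^ m) ∧ α = 1) ∨
        (Even D ∧ m = 1 ∧ α = 4) ∨
        (D = 2 ∧ α = ((D : ℝ) ^ m) ^ 2) ∨
        (Even D ∧ α = 4 ^ m)) →
      aseGap V =
        (α * (d : ℝ) ^ n - ((halfPerpSet S).ncard : ℝ) * (D : ℝ) ^ m) /
          ((d : ℝ) ^ n * ((D : ℝ) ^ m + 1) * ((D : ℝ) ^ m + 2) * ((D : ℝ) ^ m + 3)) :=
  theorem2_general d n S 0 D m V hV
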